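/- Let $R$ and $S$ be commutative Noetherian local rings with maximal ideals $\mathfrak m$ and $\mathfrak n$, and let $R \to S$ be a local ring homomorphism (that is, $\mathfrak m S \subseteq \mathfrak n$). Assume that $S$ has finite flat dimension over $R$, $\operatorname{fd}_R S<\infty$: there are an integer $n\ge 0$ and an exact sequence $0\to T_n\to\cdots\to T_0\to S\to 0$ of $R$-modules in which every $T_i$ is flat. For a commutative ring $A$ consider the following conditions. (SAC) For every finitely generated $A$-module $M$: if $\operatorname{Ext}_A^i(M,A)=0$ for all $i>0$ and $\operatorname{Ext}_A^i(M,M)=0$ for all sufficiently large $i$, then $\operatorname{Ext}_A^i(M,M)=0$ for all $i>0$. (ARC) For every finitely generated $A$-module $M$: if $\operatorname{Ext}_A^i(M,M\oplus A)=0$ for all $i>0$, then $M$ is projective. Then: 1. If $S$ satisfies (SAC), then $R$ satisfies (SAC). 2. If $S$ satisfies (ARC), then $R$ satisfies (ARC). -/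

import Mathlib

open CategoryTheory

universe u

/-- `ExtVanishes R M N i` means `Ext^i_R(M, N) = 0`. -/
def ExtVanishes (R : Type u) [CommRing R] (M N : Type u) [AddCommGroup M] [Module R M]
    [AddCommGroup N] [Module R N] (i : ℕ) : Prop :=
  Subsingleton (Abelian.Ext.{u} (ModuleCat.of R M) (ModuleCat.of R N) i)

/-- The symmetric Auslander condition (SAC): every finitely generated `R`-module `M` with
`Ext^i_R(M, R) = 0` for all `i > 0` and `Ext^i_R(M, M) = 0` for all large enough `i` has
`Ext^i_R(M, M) = 0` for all `i > 0`. -/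
def SymmetricAuslanderCondition (R : Type u) [CommRing R] : Prop :=
  ∀ (M : Type u) [AddCommGroup M] [Module R M] [Module.Finite R M],
    (∀ i : ℕ, 0 < i → ExtVanishes R M R i) →
    (∃ n : ℕ, ∀ i : ℕ, n < i → ExtVanishes R M M i) →
    ∀ i : ℕ, 0 < i → ExtVanishes R M M i

/-- The Auslander-Reiten condition (ARC): every finitely generated `R`-module `M` with
`Ext^i_R(M, M ⊕ R) = 0` for all `i > 0` is projective. -/
def AuslanderReitenCondition (R : Type u) [CommRing R] : Prop :=
  ∀ (M : Type u) [AddCommGroup M] [Module R M] [Module.Finite R M],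
    (∀ i : ℕ, 0 < i → ExtVanishes R M (M × R) i) → Module.Projective R M

/-- `M` has finite flat dimension over `R`: there is an exact sequence
`0 → T n → ⋯ → T 0 → M → 0` of `R`-modules with all `T i` flat. The sequence is extended by
zero modules in degrees above `n`, so that exactness at `T n` says that `T n → T (n - 1)`
(or `T 0 → M`, if `n = 0`) is injective. -/
def HasFiniteFlatDimension (R : Type u) [CommRing R] (M : Type u) [AddCommGroup M]
    [Module R M] : Prop :=
  ∃ (n : ℕ) (T : ℕ → ModuleCat.{u} R) (d : ∀ i : ℕ, T (i + 1) →ₗ[R] T i) (ε : T 0 →ₗ[R] M),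
    (∀ i : ℕ, Module.Flat R (T i)) ∧ (∀ i : ℕ, n < i → Subsingleton (T i)) ∧
    Function.Surjective ε ∧ Function.Exact (d 0) ε ∧
    ∀ i : ℕ, Function.Exact (d (i + 1)) (d i)

/-!
Passing from a finitely generated module `M` to a syzygy preserves all the conditions involved, as
long as `Ext^i_R(M, R) = 0` for `i > 0`. Since `S` has finite flat dimension, after finitely many
steps `Tor_i(S, M) = 0` for all `i > 0`, so that free resolutions of `M` stay exact over `S`.

For such modules `K` and `N`, if `Ext^i_R(K, N) = 0` for all `i > 0`, then `Hom_R(K, N)` commutes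
with base change to `S`: resolving `K` by free modules shows that `Hom_R(K, N)` is an arbitrarily
high syzygy, which again kills its higher Tor. It follows that the last nonzero `Ext^n_R(M, N)` with
`n > 0` satisfies `S ⊗ Ext^n_R(M, N) ≃ Ext^n_S(S ⊗ M, S ⊗ N)`. By Nakayama's lemma and `mS ≠ S` the
right-hand side is nonzero too, so the vanishing of Ext can be tested over `S`.

For (ARC), projectivity of `M` descends because `M` is projective as soon as `Ext^1_R(M, K) = 0` for
a first syzygy `K` of `M`, and this vanishing can be tested over `S`.
-/

open TensorProduct

section IsShortExact

variable {R A B C : Type*} [CommRing R] [AddCommGroup A] [Module R A] [AddCommGroup B] [Module R B]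
  [AddCommGroup C] [Module R C]

/-- `0 → A → B → C → 0` is a short exact sequence of modules. In contrast to
`CategoryTheory.ShortComplex.ShortExact`, this is stated for unbundled linear maps. -/
structure IsShortExact (f : A →ₗ[R] B) (g : B →ₗ[R] C) : Prop where
  injective : Function.Injective f
  exact : Function.Exact f g
  surjective : Function.Surjective g

theorem isShortExact_ker {g : B →ₗ[R] C} (hg : Function.Surjective g) :
    IsShortExact (LinearMap.ker g).subtype g :=
  ⟨(LinearMap.ker g).injective_subtype, LinearMap.exact_subtype_ker_map g, hg⟩

theorem surjective_iff_subsingleton_of_exact {f : A →ₗ[R] B} {g : B →ₗ[R] C}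
    (hfg : Function.Exact f g) (hg : Function.Surjective g) :
    Function.Surjective f ↔ Subsingleton C := by
  refine ⟨fun hf ↦ subsingleton_of_forall_eq 0 fun c ↦ ?_,
    fun _ b ↦ (hfg b).mp (Subsingleton.elim _ _)⟩
  obtain ⟨b, rfl⟩ := hg c
  exact (hfg b).mpr (hf b)

theorem IsShortExact.shortExact {R A B C : Type u} [CommRing R] [AddCommGroup A] [Module R A]
    [AddCommGroup B] [Module R B] [AddCommGroup C] [Module R C] {f : A →ₗ[R] B} {g : B →ₗ[R] C}
    (h : IsShortExact f g) :
    (ModuleCat.shortComplexOfCompEqZero f g h.exact.linearMap_comp_eq_zero).ShortExact :=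
  ModuleCat.shortComplex_shortExact _ h.exact h.injective h.surjective

end IsShortExact

section MemAdd

variable {R F X N : Type*} [CommRing R] [AddCommGroup F] [Module R F] [AddCommGroup X] [Module R X]
  [AddCommGroup N] [Module R N]

/-- `X` lies in `add N`, i.e. it is a direct summand of a finite direct sum of copies of `N`. The
inclusion of `X` into the direct sum and the retraction onto `X` are given by their components. -/
def MemAdd (R X N : Type*) [CommRing R] [AddCommGroup X] [Module R X] [AddCommGroup N]
    [Module R N] : Prop :=
  ∃ (n : ℕ) (a : Fin n → X →ₗ[R] N) (b : Fin n → N →ₗ[R] X), ∑ j, b j ∘ₗ a j = .id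

theorem memAdd_of_comp_eq_id (a : X →ₗ[R] N) (b : N →ₗ[R] X) (h : b ∘ₗ a = .id) :
    MemAdd R X N :=
  ⟨1, fun _ ↦ a, fun _ ↦ b, by simpa using h⟩

theorem memAdd_of_finite_projective [Module.Finite R F] [Module.Projective R F] :
    MemAdd R F R := by
  obtain ⟨n, f, g, -, -, hfg⟩ := Module.Finite.exists_comp_eq_id_of_projective R F
  refine ⟨n, fun j ↦ .proj j ∘ₗ g, fun j ↦ f ∘ₗ .single R (fun _ ↦ R) j, LinearMap.ext fun x ↦ ?_⟩
  simpa [← map_sum, LinearMap.sum_single_apply] using LinearMap.congr_fun hfg x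

theorem MemAdd.linearMap (h : MemAdd R F R) : MemAdd R (F →ₗ[R] N) N := by
  obtain ⟨n, a, b, hab⟩ := h
  refine ⟨n, fun j ↦ LinearMap.applyₗ (b j 1), fun j ↦ LinearMap.smulRightₗ (a j), ?_⟩
  ext f x
  have hx := LinearMap.congr_fun hab x
  simp only [LinearMap.sum_apply, LinearMap.comp_apply, LinearMap.id_apply] at hx
  have hba (j) : b j (a j x) = a j x • b j 1 := by rw [← map_smul, smul_eq_mul, mul_one]
  conv_rhs => rw [LinearMap.id_apply, ← hx]
  simp [hba]

end MemAdd

section ExtVanishes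

variable {R : Type u} [CommRing R]
  {K F M N N' : Type u} [AddCommGroup K] [Module R K] [AddCommGroup F] [Module R F]
  [AddCommGroup M] [Module R M] [AddCommGroup N] [Module R N] [AddCommGroup N'] [Module R N']
  {n : ℕ}

theorem ExtVanishes.eq_zero (h : ExtVanishes R M N n)
    (x : Abelian.Ext.{u} (ModuleCat.of R M) (ModuleCat.of R N) n) : x = 0 :=
  Subsingleton.elim (h := h) x 0

theorem extVanishes_of_forall_eq_zero
    (h : ∀ x : Abelian.Ext.{u} (ModuleCat.of R M) (ModuleCat.of R N) n, x = 0) :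
    ExtVanishes R M N n :=
  subsingleton_of_forall_eq 0 h

theorem extVanishes_of_projective [Module.Projective R M] (hn : 0 < n) : ExtVanishes R M N n := by
  obtain ⟨m, rfl⟩ := Nat.exists_eq_succ_of_ne_zero hn.ne'
  exact Abelian.Ext.subsingleton_of_projective _ _ _

theorem ExtVanishes.of_memAdd (h : ExtVanishes R M N n) (hN' : MemAdd R N' N) :
    ExtVanishes R M N' n := by
  obtain ⟨m, a, b, hab⟩ := hN'
  have hid : 𝟙 (ModuleCat.of R N') = ∑ j, ModuleCat.ofHom (a j) ≫ ModuleCat.ofHom (b j) := by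
    ext x
    simpa using (LinearMap.congr_fun hab x).symm
  refine extVanishes_of_forall_eq_zero fun x ↦ ?_
  rw [← x.comp_mk₀_id, hid, Abelian.Ext.mk₀_sum, Abelian.Ext.comp_sum]
  refine Finset.sum_eq_zero fun j _ ↦ ?_
  rw [← Abelian.Ext.mk₀_comp_mk₀, ← Abelian.Ext.comp_assoc_of_second_deg_zero,
    h.eq_zero (x.comp _ _), Abelian.Ext.zero_comp]

theorem extVanishes_prod_iff :
    ExtVanishes R M (N × N') n ↔ ExtVanishes R M N n ∧ ExtVanishes R M N' n := by
  refine ⟨fun h ↦ ⟨h.of_memAdd <| memAdd_of_comp_eq_id _ _ (LinearMap.fst_comp_inl R N N'),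
    h.of_memAdd <| memAdd_of_comp_eq_id _ _ (LinearMap.snd_comp_inr R N N')⟩, fun ⟨h, h'⟩ ↦ ?_⟩
  have hid : 𝟙 (ModuleCat.of R (N × N')) =
      ModuleCat.ofHom (.fst R N N') ≫ ModuleCat.ofHom (.inl R N N') +
        ModuleCat.ofHom (.snd R N N') ≫ ModuleCat.ofHom (.inr R N N') :=
    ModuleCat.hom_ext (by ext <;> simp)
  refine extVanishes_of_forall_eq_zero fun x ↦ ?_
  rw [← x.comp_mk₀_id, hid, Abelian.Ext.mk₀_add, Abelian.Ext.comp_add,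
    ← Abelian.Ext.mk₀_comp_mk₀, ← Abelian.Ext.mk₀_comp_mk₀,
    ← Abelian.Ext.comp_assoc_of_second_deg_zero, ← Abelian.Ext.comp_assoc_of_second_deg_zero,
    h.eq_zero (x.comp _ _), h'.eq_zero (x.comp _ _), Abelian.Ext.zero_comp,
    Abelian.Ext.zero_comp, add_zero]

namespace IsShortExact

theorem extVanishes_succ_left_iff {i : K →ₗ[R] F} {p : F →ₗ[R] M} (h : IsShortExact i p)
    (h₀ : ExtVanishes R F N n) (h₁ : ExtVanishes R F N (n + 1)) :
    ExtVanishes R M N (n + 1) ↔ ExtVanishes R K N n := by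
  refine ⟨fun hM ↦ extVanishes_of_forall_eq_zero fun x ↦ ?_,
    fun hK ↦ extVanishes_of_forall_eq_zero fun x ↦ ?_⟩
  · obtain ⟨y, rfl⟩ := Abelian.Ext.contravariant_sequence_exact₁ h.shortExact (ModuleCat.of R N) x
      (add_comm 1 n) (hM.eq_zero _)
    rw [h₀.eq_zero y, Abelian.Ext.comp_zero]
  · obtain ⟨y, rfl⟩ := Abelian.Ext.contravariant_sequence_exact₃ h.shortExact (ModuleCat.of R N) x
      (h₁.eq_zero _) (add_comm 1 n)
    rw [hK.eq_zero y, Abelian.Ext.comp_zero]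

theorem extVanishes_succ_right_iff {i : K →ₗ[R] F} {p : F →ₗ[R] N} (h : IsShortExact i p)
    (h₀ : ExtVanishes R M F n) (h₁ : ExtVanishes R M F (n + 1)) :
    ExtVanishes R M K (n + 1) ↔ ExtVanishes R M N n := by
  refine ⟨fun hK ↦ extVanishes_of_forall_eq_zero fun x ↦ ?_,
    fun hN ↦ extVanishes_of_forall_eq_zero fun x ↦ ?_⟩
  · obtain ⟨y, rfl⟩ := Abelian.Ext.covariant_sequence_exact₃ (ModuleCat.of R M) h.shortExact x
      rfl (hK.eq_zero _)
    rw [h₀.eq_zero y, Abelian.Ext.zero_comp]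
  · obtain ⟨y, rfl⟩ := Abelian.Ext.covariant_sequence_exact₁ (ModuleCat.of R M) h.shortExact x
      (h₁.eq_zero _) rfl
    rw [hN.eq_zero y, Abelian.Ext.zero_comp]

variable {i : K →ₗ[R] F} {p : F →ₗ[R] M} (h : IsShortExact i p)

include h

theorem extVanishes_succ_iff [Module.Projective R F] (hn : 0 < n) :
    ExtVanishes R M N (n + 1) ↔ ExtVanishes R K N n :=
  h.extVanishes_succ_left_iff (extVanishes_of_projective hn) (extVanishes_of_projective n.succ_pos)

theorem extVanishes_one_iff [Module.Projective R F] :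
    ExtVanishes R M N 1 ↔ Function.Surjective (i.lcomp R N) := by
  refine ⟨fun hM f ↦ ?_, fun hi ↦ extVanishes_of_forall_eq_zero fun x ↦ ?_⟩
  · obtain ⟨y, hy⟩ := Abelian.Ext.contravariant_sequence_exact₁ h.shortExact (ModuleCat.of R N)
      (Abelian.Ext.mk₀ (ModuleCat.ofHom f)) rfl (hM.eq_zero _)
    obtain ⟨g, rfl⟩ := (Abelian.Ext.mk₀_bijective _ _).2 y
    rw [Abelian.Ext.mk₀_comp_mk₀, (Abelian.Ext.mk₀_bijective _ _).1.eq_iff] at hy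
    exact ⟨g.hom, congrArg ModuleCat.Hom.hom hy⟩
  · obtain ⟨y, rfl⟩ := Abelian.Ext.contravariant_sequence_exact₃ h.shortExact (ModuleCat.of R N) x
      (Abelian.Ext.eq_zero_of_projective _) (n₀ := 0) rfl
    obtain ⟨f, rfl⟩ := (Abelian.Ext.mk₀_bijective _ _).2 y
    obtain ⟨g, hg⟩ := hi f.hom
    have hf : f = ModuleCat.ofHom i ≫ ModuleCat.ofHom g := ModuleCat.hom_ext hg.symm
    rw [hf, ← Abelian.Ext.mk₀_comp_mk₀]
    exact h.shortExact.extClass_comp_assoc _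

theorem lcomp [Module.Projective R F] (hM : ExtVanishes R M N 1) :
    IsShortExact (p.lcomp R N) (i.lcomp R N) :=
  ⟨p.lcomp_injective_of_surjective h.surjective,
    LinearMap.exact_lcomp_of_exact_of_surjective _ h.exact h.surjective,
    h.extVanishes_one_iff.mp hM⟩

theorem projective_of_extVanishes_one [Module.Projective R F] (hM : ExtVanishes R M K 1) :
    Module.Projective R M := by
  obtain ⟨r, hr⟩ := h.extVanishes_one_iff.mp hM .id
  have hsplit := (Function.Exact.split_tfae h.exact h.injective h.surjective).out 0 1
  obtain ⟨s, hs⟩ := hsplit.mpr ⟨r, hr⟩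
  exact Module.Projective.of_split s p hs

end IsShortExact

end ExtVanishes

section ExtVanishesAbove

variable {R : Type u} [CommRing R]
  {K F M K' F' M' N N' : Type u} [AddCommGroup K] [Module R K] [AddCommGroup F] [Module R F]
  [AddCommGroup M] [Module R M] [AddCommGroup K'] [Module R K'] [AddCommGroup F'] [Module R F']
  [AddCommGroup M'] [Module R M'] [AddCommGroup N] [Module R N] [AddCommGroup N'] [Module R N']
  {n : ℕ}

/-- `Ext^i_R(M, N) = 0` for all `i > n`. -/
def ExtVanishesAbove (R : Type u) [CommRing R] (M N : Type u) [AddCommGroup M] [Module R M]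
    [AddCommGroup N] [Module R N] (n : ℕ) : Prop :=
  ∀ i, n < i → ExtVanishes R M N i

theorem ExtVanishesAbove.mono {m : ℕ} (h : ExtVanishesAbove R M N m) (hmn : m ≤ n) :
    ExtVanishesAbove R M N n :=
  fun i hi ↦ h i (hmn.trans_lt hi)

theorem ExtVanishesAbove.of_succ (h : ExtVanishesAbove R M N (n + 1))
    (h' : ExtVanishes R M N (n + 1)) : ExtVanishesAbove R M N n := by
  intro i hi
  obtain rfl | hi := Nat.eq_or_lt_of_le (Nat.succ_le_of_lt hi)
  exacts [h', h i hi]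

theorem ExtVanishesAbove.of_memAdd (h : ExtVanishesAbove R M N n) (hN' : MemAdd R N' N) :
    ExtVanishesAbove R M N' n :=
  fun i hi ↦ (h i hi).of_memAdd hN'

theorem extVanishesAbove_of_projective [Module.Projective R M] : ExtVanishesAbove R M N n :=
  fun _ hi ↦ extVanishes_of_projective (n.zero_le.trans_lt hi)

namespace IsShortExact

theorem extVanishesAbove_right {i : K →ₗ[R] F} {p : F →ₗ[R] N} (h : IsShortExact i p)
    (hF : ExtVanishesAbove R M F n) (hN : ExtVanishesAbove R M N n) :
    ExtVanishesAbove R M K (n + 1) := by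
  intro j hj
  obtain ⟨j, rfl⟩ := Nat.exists_eq_succ_of_ne_zero (Nat.ne_zero_of_lt hj)
  have hj := Nat.lt_of_succ_lt_succ hj
  exact (h.extVanishes_succ_right_iff (hF j hj) (hF _ (Nat.lt_succ_of_lt hj))).mpr (hN j hj)

variable {i : K →ₗ[R] F} {p : F →ₗ[R] M} (h : IsShortExact i p)

include h

theorem extVanishesAbove_left [Module.Projective R F] (hM : ExtVanishesAbove R M N (n + 1)) :
    ExtVanishesAbove R K N n :=
  fun _ hj ↦ (h.extVanishes_succ_iff (n.zero_le.trans_lt hj)).mp (hM _ (Nat.succ_lt_succ hj))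

theorem extVanishes_syzygy_iff [Module.Projective R F] {i' : K' →ₗ[R] F'} {p' : F' →ₗ[R] M'}
    (h' : IsShortExact i' p') [Module.Finite R F'] [Module.Projective R F']
    (hM : ExtVanishesAbove R M R 0) (hn : 0 < n) :
    ExtVanishes R K K' n ↔ ExtVanishes R M M' n := by
  have hF' : ExtVanishesAbove R M F' 0 := hM.of_memAdd memAdd_of_finite_projective
  rw [← h.extVanishes_succ_iff hn]
  exact h'.extVanishes_succ_right_iff (hF' n hn) (hF' _ n.succ_pos)

end IsShortExact

end ExtVanishesAbove

section Tor

variable {R : Type u} [CommRing R] {Y : Type u} [AddCommGroup Y] [Module R Y]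

/-- A flat resolution `⋯ → T 1 → T 0 → Y → 0` of the `R`-module `Y`. -/
structure FlatResolution (R : Type u) [CommRing R] (Y : Type u) [AddCommGroup Y] [Module R Y] where
  T : ℕ → ModuleCat.{u} R
  d : ∀ i, T (i + 1) →ₗ[R] T i
  ε : T 0 →ₗ[R] Y
  flat : ∀ i, Module.Flat R (T i)
  surjective : Function.Surjective ε
  exact_zero : Function.Exact (d 0) ε
  exact_succ : ∀ i, Function.Exact (d (i + 1)) (d i)

namespace FlatResolution

attribute [instance] FlatResolution.flat

/-- The resolution `0 → T n → ⋯ → T 0 → Y → 0` stops in degree `n`. -/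
def LengthLE (P : FlatResolution R Y) (n : ℕ) : Prop :=
  ∀ i, n < i → Subsingleton (P.T i)

theorem isShortExact_zero (P : FlatResolution R Y) :
    IsShortExact (LinearMap.range (P.d 0)).subtype P.ε where
  injective := Submodule.injective_subtype _
  exact := by simpa [Function.Exact] using P.exact_zero
  surjective := P.surjective

theorem isShortExact_succ (P : FlatResolution R Y) (i : ℕ) :
    IsShortExact (LinearMap.range (P.d (i + 1))).subtype (P.d i).rangeRestrict where
  injective := Submodule.injective_subtype _
  exact := by
    simpa [Function.Exact, LinearMap.rangeRestrict, Subtype.ext_iff] using P.exact_succ i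
  surjective := LinearMap.surjective_rangeRestrict _

end FlatResolution

theorem HasFiniteFlatDimension.exists_flatResolution (h : HasFiniteFlatDimension R Y) :
    ∃ (P : FlatResolution R Y) (n : ℕ), P.LengthLE n := by
  obtain ⟨n, T, d, ε, hflat, hlen, hε, hexact₀, hexact⟩ := h
  exact ⟨⟨T, d, ε, hflat, hε, hexact₀, hexact⟩, n, hlen⟩

/-- `Tor_i(Y, X) = 0` for all `i > k`. Since `P` is a flat resolution of `Y`, the group
`Tor_{i+1}(Y, X)` is the kernel of `Z ⊗ X → T i ⊗ X`, where `Z = range (d i)` is the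
`(i + 1)`-st syzygy of `Y`. -/
def TorVanishesAbove (P : FlatResolution R Y) (k : ℕ) (X : Type*) [AddCommGroup X] [Module R X] :
    Prop :=
  ∀ i, k ≤ i → Function.Injective ((LinearMap.range (P.d i)).subtype.rTensor X)

variable {P : FlatResolution R Y} {k : ℕ}

theorem MemAdd.rTensor_injective {A B X N : Type*} [AddCommGroup A] [Module R A] [AddCommGroup B]
    [Module R B] [AddCommGroup X] [Module R X] [AddCommGroup N] [Module R N] (h : MemAdd R X N)
    {f : A →ₗ[R] B} (hf : Function.Injective (f.rTensor N)) :
    Function.Injective (f.rTensor X) := by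
  obtain ⟨n, a, b, hab⟩ := h
  refine (injective_iff_map_eq_zero _).mpr fun x hx ↦ ?_
  have ha (j) : (a j).lTensor A x = 0 := hf <| by
    rw [map_zero, ← LinearMap.comp_apply, LinearMap.rTensor_comp_lTensor,
      ← LinearMap.lTensor_comp_rTensor, LinearMap.comp_apply, hx, map_zero]
  calc x = (∑ j, b j ∘ₗ a j).lTensor A x := by rw [hab, LinearMap.lTensor_id_apply]
    _ = ∑ j, (b j).lTensor A ((a j).lTensor A x) := by
      rw [← LinearMap.coe_lTensorHom, map_sum, LinearMap.sum_apply]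
      simp [LinearMap.lTensor_comp]
    _ = 0 := by simp [ha]

variable {A B X : Type*} [AddCommGroup A] [Module R A] [AddCommGroup B] [Module R B]
  [AddCommGroup X] [Module R X]

theorem TorVanishesAbove.mono {l : ℕ} (h : TorVanishesAbove P k X) (hkl : k ≤ l) :
    TorVanishesAbove P l X :=
  fun i hi ↦ h i (hkl.trans hi)

theorem TorVanishesAbove.of_memAdd (h : TorVanishesAbove P k X) (hA : MemAdd R A X) :
    TorVanishesAbove P k A :=
  fun i hi ↦ hA.rTensor_injective (h i hi)

theorem FlatResolution.LengthLE.torVanishesAbove (hP : P.LengthLE k) : TorVanishesAbove P k X := by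
  intro i hi
  have : Subsingleton (P.T (i + 1)) := hP _ (Nat.lt_succ_of_le hi)
  have : Subsingleton (LinearMap.range (P.d i)) :=
    (LinearMap.surjective_rangeRestrict (P.d i)).subsingleton
  exact Function.injective_of_subsingleton _

theorem torVanishesAbove_of_flat [Module.Flat R X] : TorVanishesAbove P k X :=
  fun _ _ ↦ Module.Flat.rTensor_preserves_injective_linearMap _ (Submodule.injective_subtype _)

theorem IsShortExact.torVanishesAbove_left {i : A →ₗ[R] B} {p : B →ₗ[R] X}
    (h : IsShortExact i p) (hB : TorVanishesAbove P k B) (hX : TorVanishesAbove P (k + 1) X) :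
    TorVanishesAbove P k A := by
  intro j hj
  have hi : Function.Injective (i.lTensor (LinearMap.range (P.d j))) :=
    lTensor_injective_of_exact_of_exact_of_rTensor_injective (P.isShortExact_succ j).exact
      (P.isShortExact_succ j).surjective h.exact h.surjective (hX _ (Nat.succ_le_succ hj))
      (Module.Flat.lTensor_preserves_injective_linearMap _ h.injective)
  have hcomp := (hB j hj).comp hi
  rw [← LinearMap.coe_comp, LinearMap.rTensor_comp_lTensor, ← LinearMap.lTensor_comp_rTensor,
    LinearMap.coe_comp] at hcomp
  exact hcomp.of_comp

theorem IsShortExact.baseChange {S : Type u} [CommRing S] [Algebra R S] {P : FlatResolution R S}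
    {i : A →ₗ[R] B} {p : B →ₗ[R] X} (h : IsShortExact i p) (hX : TorVanishesAbove P 0 X) :
    IsShortExact (i.baseChange S) (p.baseChange S) where
  injective :=
    lTensor_injective_of_exact_of_exact_of_rTensor_injective P.isShortExact_zero.exact
      P.surjective h.exact h.surjective (hX 0 le_rfl)
      (Module.Flat.lTensor_preserves_injective_linearMap _ h.injective)
  exact := lTensor_exact S h.exact h.surjective
  surjective := LinearMap.lTensor_surjective S h.surjective

section Noetherian

variable [IsNoetherianRing R] {K N : Type u} [AddCommGroup K] [Module R K] [Module.Finite R K]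
  [AddCommGroup N] [Module R N] {n : ℕ}

theorem TorVanishesAbove.linearMap (hP : P.LengthLE n) (hN : TorVanishesAbove P k N)
    (hK : ExtVanishesAbove R K N 0) : TorVanishesAbove P k (K →ₗ[R] N) := by
  obtain hnk | hkn := le_total n k
  · exact hP.torVanishesAbove.mono hnk
  induction hkn using Nat.decreasingInduction generalizing K with
  | self => exact hP.torVanishesAbove
  | of_succ k _ ih =>
    obtain ⟨b, p, hp⟩ := Module.Finite.exists_fin' R K
    have h := isShortExact_ker hp
    exact (h.lcomp (hK 1 one_pos)).torVanishesAbove_left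
      (hN.of_memAdd memAdd_of_finite_projective.linearMap)
      (ih (hN.mono k.le_succ) (h.extVanishesAbove_left (hK.mono zero_le_one)))

theorem FlatResolution.LengthLE.syzygy_induction (hP : P.LengthLE n)
    {motive : ∀ (M : Type u) [AddCommGroup M] [Module R M], Prop}
    (torVanishes : ∀ (M : Type u) [AddCommGroup M] [Module R M] [Module.Finite R M],
      TorVanishesAbove P 0 M → motive M)
    (syzygy : ∀ (M : Type u) [AddCommGroup M] [Module R M] (b : ℕ) (p : (Fin b → R) →ₗ[R] M),
      Function.Surjective p → motive (LinearMap.ker p) → motive M)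
    (M : Type u) [AddCommGroup M] [Module R M] [Module.Finite R M] : motive M := by
  suffices ∀ k, TorVanishesAbove P k M → motive M from this n hP.torVanishesAbove
  intro k hM
  induction k generalizing M with
  | zero => exact torVanishes M hM
  | succ k ih =>
    obtain ⟨b, p, hp⟩ := Module.Finite.exists_fin' R M
    exact syzygy M b p hp
      (ih _ ((isShortExact_ker hp).torVanishesAbove_left torVanishesAbove_of_flat hM))

end Noetherian

end Tor

theorem subsingleton_of_subsingleton_tensorProduct {R S A : Type*} [CommRing R] [CommRing S]
    [Algebra R S] [AddCommGroup A] [Module R A] [Module.Finite R A]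
    (hRS : ∀ m : Ideal R, m.IsMaximal → m.map (algebraMap R S) ≠ ⊤)
    [Subsingleton (S ⊗[R] A)] : Subsingleton A := by
  by_contra hA
  rw [not_subsingleton_iff_nontrivial] at hA
  obtain ⟨N, hN, -⟩ := (eq_top_or_exists_le_coatom (⊥ : Submodule R A)).resolve_left bot_ne_top
  obtain ⟨m, hm, ⟨e⟩⟩ := isSimpleModule_iff_quot_maximal.mp (isSimpleModule_iff_isCoatom.mpr hN)
  have : Subsingleton (S ⊗[R] (R ⧸ m)) :=
    (LinearMap.lTensor_surjective S (g := e.toLinearMap ∘ₗ N.mkQ)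
      (e.surjective.comp N.mkQ_surjective)).subsingleton
  have : Subsingleton (S ⧸ m.map (algebraMap R S)) :=
    (Algebra.TensorProduct.quotIdealMapEquivTensorQuot S m).injective.subsingleton
  exact hRS m hm (Ideal.Quotient.subsingleton_iff.mp this)

section LinearMapTensorProduct

variable {R S K F N : Type*} [CommRing R] [CommRing S] [Algebra R S] [AddCommGroup K] [Module R K]
  [AddCommGroup F] [Module R F] [AddCommGroup N] [Module R N]

theorem tensorProduct_comp_baseChange_lcomp (g : K →ₗ[R] F) :
    LinearMap.tensorProduct R S K N ∘ₗ (g.lcomp R N).baseChange S =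
      (g.baseChange S).lcomp S (S ⊗[R] N) ∘ₗ LinearMap.tensorProduct R S F N := by
  ext f x
  rfl

theorem tensorProduct_pi_bijective (ι : Type*) [Finite ι] :
    Function.Bijective (LinearMap.tensorProduct R S (ι → R) N) := by
  have hequiv : LinearMap.tensorProduct R S (ι → R) N =
      (Module.isBaseChange_map_of_finite_free N S ι).equiv.toLinearMap := by
    refine TensorProduct.AlgebraTensorModule.ext fun s f ↦ ?_
    rw [LinearEquiv.coe_coe, IsBaseChange.equiv_tmul]
    rfl
  exact hequiv ▸ LinearEquiv.bijective _

end LinearMapTensorProduct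

section BaseChange

variable {R : Type u} [CommRing R] {S : Type u} [CommRing S] [Algebra R S]
  {K F M N : Type u} [AddCommGroup K] [Module R K] [AddCommGroup F] [Module R F]
  [AddCommGroup M] [Module R M] [AddCommGroup N] [Module R N] {l n : ℕ}
  [IsNoetherianRing R] {P : FlatResolution R S} [Module.Finite R K]

theorem tensorProduct_injective (hP : P.LengthLE l) (hN : TorVanishesAbove P 0 N)
    (hK : ExtVanishesAbove R K N 0) : Function.Injective (LinearMap.tensorProduct R S K N) := by
  obtain ⟨b, p, hp⟩ := Module.Finite.exists_fin' R K
  have h := isShortExact_ker hp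
  have hlcomp := (h.lcomp (hK 1 one_pos)).baseChange
    (hN.linearMap hP (h.extVanishesAbove_left (hK.mono zero_le_one)))
  have hinj := (tensorProduct_pi_bijective (R := R) (S := S) (N := N) (Fin b)).injective.comp
    hlcomp.injective
  rw [← LinearMap.coe_comp, tensorProduct_comp_baseChange_lcomp, LinearMap.coe_comp] at hinj
  exact hinj.of_comp

theorem tensorProduct_bijective (hP : P.LengthLE l) (hN : TorVanishesAbove P 0 N)
    (hK : ExtVanishesAbove R K N 0) : Function.Bijective (LinearMap.tensorProduct R S K N) := by
  obtain ⟨b, p, hp⟩ := Module.Finite.exists_fin' R K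
  have h := isShortExact_ker hp
  have hK' := h.extVanishesAbove_left (hK.mono zero_le_one)
  have hlcomp := (h.lcomp (hK 1 one_pos)).baseChange (hN.linearMap hP hK')
  have hpS : Function.Surjective (p.baseChange S) := LinearMap.lTensor_surjective S hp
  have hexactS : Function.Exact ((LinearMap.ker p).subtype.baseChange S) (p.baseChange S) :=
    lTensor_exact S h.exact hp
  exact LinearMap.bijective_of_bijective_of_injective_of_left_exact _ _ _ _ _ _ _
    (tensorProduct_comp_baseChange_lcomp p).symm
    (tensorProduct_comp_baseChange_lcomp (LinearMap.ker p).subtype).symm hlcomp.exact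
    (LinearMap.exact_lcomp_of_exact_of_surjective _ hexactS hpS)
    (tensorProduct_pi_bijective _) (tensorProduct_injective hP hN hK') hlcomp.injective
    ((p.baseChange S).lcomp_injective_of_surjective hpS)

theorem IsShortExact.extVanishes_one_baseChange_iff [Module.Finite R F] [Module.Projective R F]
    {i : K →ₗ[R] F} {p : F →ₗ[R] M} (h : IsShortExact i p) (hP : P.LengthLE l)
    (hM : TorVanishesAbove P 0 M) (hN : TorVanishesAbove P 0 N) (hK : ExtVanishesAbove R K N 0) :
    ExtVanishes S (S ⊗[R] M) (S ⊗[R] N) 1 ↔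
      Function.Surjective ((i.lcomp R N).baseChange S) := by
  have hFbij := tensorProduct_bijective hP hN (extVanishesAbove_of_projective (M := F))
  have hKbij := tensorProduct_bijective hP hN hK
  rw [(h.baseChange hM).extVanishes_one_iff,
    ← Function.Surjective.of_comp_iff _ hFbij.surjective, ← LinearMap.coe_comp,
    ← tensorProduct_comp_baseChange_lcomp, LinearMap.coe_comp,
    Function.Surjective.of_comp_iff' hKbij]

variable [Module.Finite R M] [Module.Finite R N]

/- If the `Ext^i_R(M, N)` with `i > n + 1` vanish, then `Ext^{n+1}` commutes with base change, so
that `E` can be taken to be `Ext^{n+1}_R(M, N)`. -/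
theorem exists_extVanishes_iff_subsingleton (hP : P.LengthLE l) (hM : TorVanishesAbove P 0 M)
    (hN : TorVanishesAbove P 0 N) (h : ExtVanishesAbove R M N (n + 1)) :
    ∃ (E : Type u) (_ : AddCommGroup E) (_ : Module R E), Module.Finite R E ∧
      (ExtVanishes R M N (n + 1) ↔ Subsingleton E) ∧
      (ExtVanishes S (S ⊗[R] M) (S ⊗[R] N) (n + 1) ↔ Subsingleton (S ⊗[R] E)) := by
  induction n generalizing M with
  | zero =>
    obtain ⟨b, p, hp⟩ := Module.Finite.exists_fin' R M
    have hexact := isShortExact_ker hp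
    let f := (LinearMap.ker p).subtype.lcomp R N
    have hf := LinearMap.exact_map_mkQ_range f
    have hsurj := (LinearMap.range f).mkQ_surjective
    refine ⟨_ ⧸ LinearMap.range f, _, _, inferInstance, ?_, ?_⟩
    · rw [hexact.extVanishes_one_iff, surjective_iff_subsingleton_of_exact hf hsurj]
    · rw [hexact.extVanishes_one_baseChange_iff hP hM hN (hexact.extVanishesAbove_left h),
        surjective_iff_subsingleton_of_exact (g := (LinearMap.range f).mkQ.baseChange S)
          (lTensor_exact S hf hsurj) (LinearMap.lTensor_surjective S hsurj)]
  | succ n ih =>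
    obtain ⟨b, p, hp⟩ := Module.Finite.exists_fin' R M
    have hexact := isShortExact_ker hp
    rw [hexact.extVanishes_succ_iff n.succ_pos,
      (hexact.baseChange hM).extVanishes_succ_iff n.succ_pos]
    exact ih (hexact.torVanishesAbove_left torVanishesAbove_of_flat (hM.mono zero_le_one))
      (hexact.extVanishesAbove_left h)

theorem ExtVanishesAbove.baseChange (h : ExtVanishesAbove R M N n) (hP : P.LengthLE l)
    (hM : TorVanishesAbove P 0 M) (hN : TorVanishesAbove P 0 N) :
    ExtVanishesAbove S (S ⊗[R] M) (S ⊗[R] N) n := by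
  intro i hi
  obtain ⟨j, rfl⟩ := Nat.exists_eq_succ_of_ne_zero (Nat.ne_zero_of_lt hi)
  obtain ⟨E, _, _, _, hR, hS⟩ :=
    exists_extVanishes_iff_subsingleton hP hM hN (h.mono hi.le)
  have : Subsingleton E := hR.mp (h _ hi)
  exact hS.mpr inferInstance

theorem ExtVanishesAbove.baseChange_self (h : ExtVanishesAbove R M R n) (hP : P.LengthLE l)
    (hM : TorVanishesAbove P 0 M) : ExtVanishesAbove S (S ⊗[R] M) S n :=
  (h.baseChange hP hM torVanishesAbove_of_flat).of_memAdd <|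
    memAdd_of_comp_eq_id _ _ (TensorProduct.AlgebraTensorModule.rid R S S).comp_symm

variable (hRS : ∀ m : Ideal R, m.IsMaximal → m.map (algebraMap R S) ≠ ⊤)

include hRS

theorem ExtVanishesAbove.of_baseChange {k : ℕ} (h : ExtVanishesAbove R M N n)
    (hS : ExtVanishesAbove S (S ⊗[R] M) (S ⊗[R] N) k) (hP : P.LengthLE l)
    (hM : TorVanishesAbove P 0 M) (hN : TorVanishesAbove P 0 N) : ExtVanishesAbove R M N k := by
  obtain hnk | hkn := le_total n k
  · exact h.mono hnk
  induction hkn using Nat.decreasingInduction with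
  | self => exact h
  | of_succ k _ ih =>
    have hk := ih (hS.mono k.le_succ)
    obtain ⟨E, _, _, _, hRE, hSE⟩ := exists_extVanishes_iff_subsingleton hP hM hN hk
    have := hSE.mp (hS _ k.lt_succ_self)
    exact hk.of_succ (hRE.mpr (subsingleton_of_subsingleton_tensorProduct (S := S) hRS))

theorem FlatResolution.LengthLE.symmetricAuslanderCondition_of_baseChange (hP : P.LengthLE l)
    (hS : SymmetricAuslanderCondition S) : SymmetricAuslanderCondition R := by
  intro M _ _ _
  refine hP.syzygy_induction (motive := fun M _ _ ↦ ExtVanishesAbove R M R 0 →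
    (∃ n, ExtVanishesAbove R M M n) → ExtVanishesAbove R M M 0) ?_ ?_ M
  · rintro M _ _ _ hM hMR ⟨n, hMM⟩
    exact hMM.of_baseChange hRS (hS _ (hMR.baseChange_self hP hM) ⟨n, hMM.baseChange hP hM hM⟩)
      hP hM hM
  · rintro M _ _ b p hp ih hMR ⟨n, hMM⟩ j hj
    have h := isShortExact_ker hp
    have hiff {j : ℕ} (hj : 0 < j) := h.extVanishes_syzygy_iff h hMR hj
    exact (hiff hj).mp (ih (h.extVanishesAbove_left (hMR.mono zero_le_one))
      ⟨n, fun j hj ↦ (hiff (n.zero_le.trans_lt hj)).mpr (hMM j hj)⟩ j hj)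

theorem projective_of_projective_baseChange (hP : P.LengthLE l) (hM : TorVanishesAbove P 0 M)
    (hMR : ExtVanishesAbove R M R 0) (hMM : ExtVanishesAbove R M M 0)
    [Module.Projective S (S ⊗[R] M)] : Module.Projective R M := by
  obtain ⟨b, p, hp⟩ := Module.Finite.exists_fin' R M
  have h := isShortExact_ker hp
  have hK : TorVanishesAbove P 0 (LinearMap.ker p) :=
    h.torVanishesAbove_left torVanishesAbove_of_flat (hM.mono zero_le_one)
  have hMK : ExtVanishesAbove R M (LinearMap.ker p) 1 :=
    h.extVanishesAbove_right (hMR.of_memAdd memAdd_of_finite_projective) hMM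
  exact h.projective_of_extVanishes_one
    (hMK.of_baseChange hRS extVanishesAbove_of_projective hP hM hK 1 one_pos)

theorem FlatResolution.LengthLE.auslanderReitenCondition_of_baseChange (hP : P.LengthLE l)
    (hS : AuslanderReitenCondition S) : AuslanderReitenCondition R := by
  intro M _ _ _ h
  refine hP.syzygy_induction (motive := fun M _ _ ↦ ExtVanishesAbove R M R 0 →
    ExtVanishesAbove R M M 0 → Module.Projective R M) ?_ ?_ M
    (fun i hi ↦ (extVanishes_prod_iff.mp (h i hi)).2)
    (fun i hi ↦ (extVanishes_prod_iff.mp (h i hi)).1)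
  · intro M _ _ _ hM hMR hMM
    have hSM : Module.Projective S (S ⊗[R] M) := hS _ fun i hi ↦
      extVanishes_prod_iff.mpr ⟨hMM.baseChange hP hM hM i hi, hMR.baseChange_self hP hM i hi⟩
    exact projective_of_projective_baseChange hRS hP hM hMR hMM
  · intro M _ _ b p hp ih hMR hMM
    have h := isShortExact_ker hp
    have := ih (h.extVanishesAbove_left (hMR.mono zero_le_one))
      fun j hj ↦ (h.extVanishes_syzygy_iff h hMR hj).mpr (hMM j hj)
    have : Module.Finite R M := .of_surjective p hp
    exact h.projective_of_extVanishes_one <|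
      (hMR.of_memAdd memAdd_of_finite_projective) 1 one_pos

end BaseChange

theorem theorem3p1_general (R S : Type u) [CommRing R] [IsNoetherianRing R] [CommRing S]
    [Algebra R S] (hRS : ∀ m : Ideal R, m.IsMaximal → m.map (algebraMap R S) ≠ ⊤)
    (hfd : HasFiniteFlatDimension R S) :
    (SymmetricAuslanderCondition S → SymmetricAuslanderCondition R) ∧
      (AuslanderReitenCondition S → AuslanderReitenCondition R) := by
  obtain ⟨P, n, hP⟩ := hfd.exists_flatResolution
  exact ⟨hP.symmetricAuslanderCondition_of_baseChange hRS,
    hP.auslanderReitenCondition_of_baseChange hRS⟩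

theorem theorem3p1 (R S : Type u) [CommRing R] [IsNoetherianRing R] [IsLocalRing R]
    [CommRing S] [IsNoetherianRing S] [IsLocalRing S] [Algebra R S]
    [IsLocalHom (algebraMap R S)] (hfd : HasFiniteFlatDimension R S) :
    (SymmetricAuslanderCondition S → SymmetricAuslanderCondition R) ∧
      (AuslanderReitenCondition S → AuslanderReitenCondition R) :=
  theorem3p1_general R S (fun _ hm ↦ IsLocalRing.eq_maximalIdeal hm ▸
    (IsLocalRing.map_maximalIdeal_lt_top (algebraMap R S)).ne) hfd
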